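/- Let $\{S(t):t\ge 0\}$ be a real-valued Lévy process such that $\kappa_S(\theta):=\log\mathbb{E}[e^{\theta S(1)}]$ is finite for all $\theta$ in a neighbourhood of $0$; assume that $S$ has bounded variation (almost all paths have finite variation on compact time intervals) and that $S$ is not a subordinator (a subordinator is a Lévy process with nondecreasing paths). Let $\{S_1(t):t\ge 0\}$ and $\{S_2(t):t\ge 0\}$ be two independent non-null subordinators such that $\{S(t):t\ge 0\}$ is distributed as $\{S_1(t)-S_2(t):t\ge 0\}$, and set $m_i:=\kappa_{S_i}'(0)$, where $\kappa_{S_i}(\theta):=\log\mathbb{E}[e^{\theta S_i(1)}]$, $i=1,2$. Let $\nu\in(0,1)$ and let $\{L^{(1)}_\nu(t):t\ge 0\}$ and $\{L^{(2)}_\nu(t):t\ge 0\}$ be two independent inverses of $\nu$-stable subordinators, jointly independent of $(S_1,S_2)$; that is, $L^{(i)}_\nu(t)=\inf\{s\ge 0: V^{(i)}(s)>t\}$ almost surely, where $V^{(i)}$ is a subordinator with $\mathbb{E}[e^{-\xi V^{(i)}(t)}]=e^{-t\xi^\nu}$ for all $t,\xi\ge 0$. Then, as $t\to\infty$, the random variables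 $$t^{1-\nu}\,\frac{S_1(L^{(1)}_\nu(t))-S_2(L^{(2)}_\nu(t))}{t}$$ converge weakly (in distribution) to $m_1L^{(1)}_\nu(1)-m_2L^{(2)}_\nu(1)$, where $L^{(1)}_\nu(1)$ and $L^{(2)}_\nu(1)$ are independent because the processes $L^{(1)}_\nu$ and $L^{(2)}_\nu$ are. -/

import Mathlib

open MeasureTheory ProbabilityTheory Filter Topology
open scoped NNReal

namespace TimeChange

variable {Ω : Type*} [MeasurableSpace Ω]

/-- A function on `[0, ∞)` is càdlàg: right-continuous, with a (finite) left limit at every point.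
At the point `0` the second requirement is empty. -/
def IsCadlag (f : ℝ≥0 → ℝ) : Prop :=
  ∀ t : ℝ≥0, ContinuousWithinAt f (Set.Ici t) t ∧ ∃ l : ℝ, Tendsto f (𝓝[<] t) (𝓝 l)

/-- A real-valued Lévy process `{X t : t ≥ 0}` on the probability space `(Ω, P)`. -/
structure IsLevyProcess (X : ℝ≥0 → Ω → ℝ) (P : Measure Ω) : Prop where
  measurable : ∀ t, Measurable (X t)
  zero : ∀ᵐ ω ∂P, X 0 ω = 0
  indep_increments : HasIndepIncrements X P
  stationary_increments : ∀ s h : ℝ≥0,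
    IdentDistrib (fun ω => X (s + h) ω - X s ω) (fun ω => X h ω - X 0 ω) P P
  cadlag : ∀ᵐ ω ∂P, IsCadlag (fun t => X t ω)

/-- A subordinator: a nondecreasing real-valued Lévy process. -/
structure IsSubordinator (X : ℝ≥0 → Ω → ℝ) (P : Measure Ω) : Prop extends IsLevyProcess X P where
  monotone : ∀ᵐ ω ∂P, Monotone (fun t => X t ω)

/-- The process is null, i.e. almost surely identically equal to zero. -/
def IsNull (X : ℝ≥0 → Ω → ℝ) (P : Measure Ω) : Prop :=
  ∀ᵐ ω ∂P, ∀ t, X t ω = 0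

/-- The `ν`-stable subordinator, with the normalization `E[exp(-ξ V(t))] = exp(-t ξ^ν)`. -/
structure IsStableSubordinator (ν : ℝ) (V : ℝ≥0 → Ω → ℝ) (P : Measure Ω) : Prop
    extends IsSubordinator V P where
  laplace : ∀ (t : ℝ≥0) (ξ : ℝ), 0 ≤ ξ →
    ∫ ω, Real.exp (-(ξ * V t ω)) ∂P = Real.exp (-(t * ξ ^ ν))

/-- `L` is an inverse of a `ν`-stable subordinator `V`: `L t = inf {s ≥ 0 : V s > t}`. -/
def IsInverseStableSubordinator (ν : ℝ) (L : ℝ≥0 → Ω → ℝ≥0) (P : Measure Ω) : Prop :=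
  (∀ t, Measurable (L t)) ∧
    ∃ V : ℝ≥0 → Ω → ℝ, IsStableSubordinator ν V P ∧
      ∀ᵐ ω ∂P, ∀ t : ℝ≥0, L t ω = sInf {s : ℝ≥0 | (t : ℝ) < V s ω}

/-- The path of a process, as a random element of the space of all functions on `[0, ∞)` with its
product `σ`-algebra. -/
def path {E : Type*} (X : ℝ≥0 → Ω → E) (ω : Ω) : ℝ≥0 → E := fun t => X t ω

/-- The process has bounded variation: almost all paths have finite variation on every compact
time interval. -/
def HasBoundedVariation (X : ℝ≥0 → Ω → ℝ) (P : Measure Ω) : Prop :=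
  ∀ᵐ ω ∂P, LocallyBoundedVariationOn (path X ω) Set.univ

/-- The cumulant generating function `θ ↦ log E[exp(θ X(1))]` is finite in a neighbourhood of the
origin. -/
def IsLightTailed (X : ℝ≥0 → Ω → ℝ) (P : Measure Ω) : Prop :=
  ∀ᶠ θ in 𝓝 (0 : ℝ), Integrable (fun ω => Real.exp (θ * X 1 ω)) P

end TimeChange

/-!
The proof separates the growth of the subordinators from the scaling of the time changes:
with `A i t = S i (L i t) / L i t`,
`t ^ (-ν) * S i (L i t) = A i t * (L i t / t ^ ν)`.

* The first factor converges almost surely to `m i = E[S i 1] = κ' (0)`. Indeed the strong law of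
  large numbers applies to the unit increments of a subordinator with finite mean, monotonicity of
  the paths fills in the non-integer times (`IsSubordinator.ae_tendsto_div_atTop`), and
  `L i t → ∞` because a stable subordinator is finite at each time
  (`IsInverseStableSubordinator.ae_tendsto_atTop`). The mean is finite because `exp (θ * S 1)` has
  the law of `exp (θ * S₁ 1) * exp (-θ * S₂ 1)`, a product of independent positive variables, so
  that both factors inherit its integrability
  (`zero_mem_interior_integrableExpSet_of_indepFun`).
* The second factor has the law of `L i 1` for every `t > 0`
  (`IsInverseStableSubordinator.identDistrib`). The Laplace transform gives that `V (t ^ ν * s)` and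
  `t * V s` have the same law, and the events `{V s ≤ t}` and `{s ≤ L t}` are equal up to the
  boundary event `{L t = s}`, which is enough to identify the laws of the inverses.

By independence the pair `(L₁ t, L₂ t) / t ^ ν` has the law of `(L₁ 1, L₂ 1)`. Slutsky's theorem
for the map `((x, y), (a, b)) ↦ a * x - b * y` then gives the limit.
-/

namespace TimeChange

/-! ### Measures on the half-line -/

open scoped BoundedContinuousFunction in
/-- A finite measure on `[0, ∞)` is determined by its Laplace transform at the natural numbers: the
polynomials in `x ↦ exp (-x)` form an algebra that separates points. -/
theorem ext_of_integral_exp_neg_nat {μ μ' : Measure ℝ≥0} [IsFiniteMeasure μ] [IsFiniteMeasure μ']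
    (h : ∀ n : ℕ, ∫ x : ℝ≥0, Real.exp (-(n * x)) ∂μ = ∫ x : ℝ≥0, Real.exp (-(n * x)) ∂μ') :
    μ = μ' := by
  let f : ℝ≥0 →ᵇ ℝ := BoundedContinuousFunction.ofNormedAddCommGroup
    (fun x : ℝ≥0 => Real.exp (-x)) (by fun_prop) 1 (fun x => by simp)
  let A : StarSubalgebra ℝ (ℝ≥0 →ᵇ ℝ) :=
    { Algebra.adjoin ℝ {f} with
      star_mem' := fun {g} hg => by
        have : star g = g := by ext x; simp
        rwa [this] }
  have hfA : f ∈ A := Algebra.self_mem_adjoin_singleton ℝ f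
  refine ext_of_forall_mem_subalgebra_integral_eq_of_polish (𝕜 := ℝ) (A := A) ?_ ?_
  · intro x y hxy
    refine ⟨f, ⟨f, ⟨f, hfA, rfl⟩, rfl⟩, ?_⟩
    simpa [f] using hxy
  · intro g hg
    have hg' : g ∈ Algebra.adjoin ℝ {f} := hg
    rw [Algebra.adjoin_singleton_eq_range_aeval] at hg'
    obtain ⟨p, rfl⟩ := hg'
    clear hg
    induction p using Polynomial.induction_on' with
    | add p q hp hq =>
      simp only [map_add, BoundedContinuousFunction.coe_add, Pi.add_apply]
      rw [integral_add (BoundedContinuousFunction.integrable _ _)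
        (BoundedContinuousFunction.integrable _ _), integral_add
        (BoundedContinuousFunction.integrable _ _) (BoundedContinuousFunction.integrable _ _)]
      exact congrArg₂ _ hp hq
    | monomial n a =>
      have : ∀ x : ℝ≥0, (Polynomial.aeval f (Polynomial.monomial n a)) x
          = a * Real.exp (-(n * x)) := by
        intro x
        rw [Polynomial.aeval_monomial]
        simp [f, ← Real.exp_nat_mul, BoundedContinuousFunction.algebraMap_apply]
      change ∫ x, (Polynomial.aeval f (Polynomial.monomial n a)) x ∂μ
        = ∫ x, (Polynomial.aeval f (Polynomial.monomial n a)) x ∂μ'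
      simp only [this, integral_const_mul, h n]

/-- Two probability measures are equal as soon as their tails agree up to atoms: the open tail at
`a` is the increasing limit of the tails at points decreasing to `a`, so a possible atom at the
end point is never seen. -/
theorem ext_of_measure_Ioi_le_measure_Ici {μ μ' : Measure ℝ≥0} [IsProbabilityMeasure μ]
    [IsProbabilityMeasure μ'] (h : ∀ s, μ (Set.Ioi s) ≤ μ' (Set.Ici s))
    (h' : ∀ s, μ' (Set.Ioi s) ≤ μ (Set.Ici s)) : μ = μ' := by
  have key : ∀ {ρ ρ' : Measure ℝ≥0}, (∀ s, ρ (Set.Ioi s) ≤ ρ' (Set.Ici s)) →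
      ∀ a, ρ (Set.Ioi a) ≤ ρ' (Set.Ioi a) := by
    intro ρ ρ' H a
    obtain ⟨u, hu, hua, hlim⟩ := exists_seq_strictAnti_tendsto a
    have hU : Set.Ioi a = ⋃ n, Set.Ioi (u n) := by
      ext x
      simp only [Set.mem_Ioi, Set.mem_iUnion]
      exact ⟨fun hx => ((tendsto_order.1 hlim).2 x hx).exists, fun ⟨n, hn⟩ => (hua n).trans hn⟩
    have hmono : Monotone fun n => Set.Ioi (u n) :=
      fun i j hij => Set.Ioi_subset_Ioi (hu.antitone hij)
    rw [hU, hmono.measure_iUnion, ← hU]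
    exact iSup_le fun n => (H _).trans (measure_mono fun x hx => (hua n).trans_le hx)
  refine Measure.ext_of_Iic _ _ fun a => ?_
  have hIoi := le_antisymm (key h a) (key h' a)
  rw [← Set.compl_Ioi, prob_compl_eq_one_sub measurableSet_Ioi,
    prob_compl_eq_one_sub measurableSet_Ioi, hIoi]

/-! ### Asymptotics of subordinators -/

theorem tendsto_div_atTop_of_monotone {f : ℝ≥0 → ℝ} {m : ℝ} (hf : Monotone f)
    (hm : Tendsto (fun n : ℕ => f n / n) atTop (𝓝 m)) :
    Tendsto (fun s : ℝ≥0 => f s / s) atTop (𝓝 m) := by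
  have hc : Tendsto (fun s : ℝ≥0 => (s : ℝ)) atTop atTop := NNReal.tendsto_coe_atTop.2 tendsto_id
  have h1 : Tendsto (fun s : ℝ≥0 => f ⌊(s : ℝ)⌋₊ / ⌊(s : ℝ)⌋₊ * (⌊(s : ℝ)⌋₊ / s)) atTop
      (𝓝 (m * 1)) :=
    (hm.comp (tendsto_nat_floor_atTop.comp hc)).mul (tendsto_nat_floor_div_atTop.comp hc)
  have h2 : Tendsto (fun s : ℝ≥0 => f ⌈(s : ℝ)⌉₊ / ⌈(s : ℝ)⌉₊ * (⌈(s : ℝ)⌉₊ / s)) atTop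
      (𝓝 (m * 1)) :=
    (hm.comp (tendsto_nat_ceil_atTop.comp hc)).mul (tendsto_nat_ceil_div_atTop.comp hc)
  rw [mul_one] at h1 h2
  refine tendsto_of_tendsto_of_tendsto_of_le_of_le' h1 h2 ?_ ?_
  · filter_upwards [eventually_ge_atTop 1] with s hs
    have hs' : (1 : ℝ) ≤ s := hs
    have hn : (0 : ℝ) < ⌊(s : ℝ)⌋₊ := by
      exact_mod_cast Nat.floor_pos.2 hs'
    rw [div_mul_div_cancel₀ hn.ne']
    gcongr
    exact hf (by rw [← NNReal.coe_le_coe]; simpa using Nat.floor_le s.2)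
  · filter_upwards [eventually_ge_atTop 1] with s hs
    have hs' : (1 : ℝ) ≤ s := hs
    have hn : (0 : ℝ) < ⌈(s : ℝ)⌉₊ := by
      exact_mod_cast Nat.ceil_pos.2 (by linarith)
    rw [div_mul_div_cancel₀ hn.ne']
    gcongr
    exact hf (by rw [← NNReal.coe_le_coe]; simpa using Nat.le_ceil (s : ℝ))

variable {Ω : Type*} [MeasurableSpace Ω] {P : Measure Ω}

theorem IsSubordinator.ae_nonneg {X : ℝ≥0 → Ω → ℝ} (hX : IsSubordinator X P) :
    ∀ᵐ ω ∂P, ∀ t, 0 ≤ X t ω := by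
  filter_upwards [hX.zero, hX.monotone] with ω h0 hm t
  exact h0.symm.trans_le (hm (zero_le (a := t)))

/-- The strong law of large numbers for a subordinator with finite mean. -/
theorem IsSubordinator.ae_tendsto_div_atTop {X : ℝ≥0 → Ω → ℝ}
    (hX : IsSubordinator X P) (hint : Integrable (X 1) P) :
    ∀ᵐ ω ∂P, Tendsto (fun s : ℝ≥0 => X s ω / s) atTop (𝓝 (∫ ω, X 1 ω ∂P)) := by
  have hstat : ∀ k : ℕ, IdentDistrib (fun ω => X (k + 1 : ℕ) ω - X k ω) (X 1) P P := by
    intro k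
    have h1 := hX.stationary_increments k 1
    have h2 : IdentDistrib (fun ω => X 1 ω - X 0 ω) (X 1) P P := by
      refine IdentDistrib.of_ae_eq ((hX.measurable 1).sub (hX.measurable 0)).aemeasurable ?_
      filter_upwards [hX.zero] with ω h0
      simp [h0]
    simpa using h1.trans h2
  have hind := hX.indep_increments.nat (t := fun n : ℕ => (n : ℝ≥0)) Nat.mono_cast
  have hlln := strong_law_ae_real (fun (k : ℕ) ω => X (k + 1 : ℕ) ω - X k ω)
    ((hstat 0).integrable_iff.2 hint) (fun i j hij => hind.indepFun hij)
    (fun i => (hstat i).trans (hstat 0).symm)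
  rw [(hstat 0).integral_eq] at hlln
  filter_upwards [hlln, hX.monotone, hX.zero] with ω hω hm h0
  refine tendsto_div_atTop_of_monotone hm ?_
  simpa only [Finset.sum_range_sub (fun k : ℕ => X k ω), Nat.cast_zero, h0, sub_zero] using hω

/-- A Lévy process evaluated at a random time is measurable up to a null set: by right-continuity it
is the limit of its values at random times that each take countably many values. -/
theorem IsLevyProcess.aemeasurable_comp {X : ℝ≥0 → Ω → ℝ} (hX : IsLevyProcess X P)
    {T : Ω → ℝ≥0} (hT : Measurable T) : AEMeasurable (fun ω => X (T ω) ω) P := by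
  -- `(⌊(n + 1) x⌋ + 1) / (n + 1)` approximates `x` from the right
  have hlim : ∀ x : ℝ≥0, Tendsto (fun n : ℕ => ((⌊(n + 1) * x⌋₊ + 1 : ℕ) : ℝ≥0) / (n + 1)) atTop
      (𝓝[≥] x) := by
    intro x
    have hlow : ∀ n : ℕ, x ≤ ((⌊(n + 1) * x⌋₊ + 1 : ℕ) : ℝ≥0) / (n + 1) := by
      intro n
      rw [le_div_iff₀ (by positivity), mul_comm]
      push_cast
      exact (Nat.lt_floor_add_one _).le
    refine tendsto_nhdsWithin_iff.2 ⟨?_, Eventually.of_forall hlow⟩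
    have hup : ∀ n : ℕ, ((⌊(n + 1) * x⌋₊ + 1 : ℕ) : ℝ≥0) / (n + 1) ≤ x + 1 / (n + 1) := by
      intro n
      have hn : (n : ℝ≥0) + 1 ≠ 0 := by positivity
      rw [div_le_iff₀ (by positivity), add_mul x, div_mul_cancel₀ _ hn, mul_comm x]
      push_cast
      gcongr
      exact Nat.floor_le (zero_le)
    have h1 : Tendsto (fun n : ℕ => x + 1 / ((n : ℝ≥0) + 1)) atTop (𝓝 (x + 0)) :=
      tendsto_const_nhds.add tendsto_one_div_add_atTop_nhds_zero_nat
    rw [add_zero] at h1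
    exact tendsto_of_tendsto_of_tendsto_of_le_of_le tendsto_const_nhds h1 hlow hup
  refine aemeasurable_of_tendsto_metrizable_ae' (μ := P) (f := fun (n : ℕ) ω =>
    X (((⌊(n + 1) * T ω⌋₊ + 1 : ℕ) : ℝ≥0) / (n + 1)) ω) (fun n => ?_) ?_
  · have hX' : Measurable fun p : ℕ × Ω => X (((p.1 + 1 : ℕ) : ℝ≥0) / (n + 1)) p.2 :=
      measurable_from_prod_countable_right fun k =>
        hX.measurable (((k + 1 : ℕ) : ℝ≥0) / (n + 1))
    have hfl : Measurable fun ω => (⌊(n + 1) * T ω⌋₊, ω) :=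
      (Nat.measurable_floor.comp (hT.const_mul _)).prodMk measurable_id
    exact (hX'.comp hfl).aemeasurable
  · filter_upwards [hX.cadlag] with ω hω
    exact (hω (T ω)).1.tendsto.comp (hlim (T ω))

/-! ### Exponential moments and convergence in measure -/

/-- If the difference of two independent variables has exponential moments near `0`, so do its
terms: `exp (θ X) * exp (-θ Y)` is integrable and its second factor does not vanish. -/
theorem zero_mem_interior_integrableExpSet_of_indepFun {X Y : Ω → ℝ} (hX : Measurable X)
    (hY : Measurable Y) (hXY : IndepFun X Y P)
    (h : ∀ᶠ θ in 𝓝 (0 : ℝ), Integrable (fun ω => Real.exp (θ * (X ω - Y ω))) P) :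
    0 ∈ interior (integrableExpSet X P) := by
  rcases eq_zero_or_neZero P with rfl | hP
  · simp [integrableExpSet]
  rw [mem_interior_iff_mem_nhds]
  filter_upwards [h] with θ hθ
  have hf : Measurable fun x : ℝ => Real.exp (θ * x) := by fun_prop
  have hg : Measurable fun x : ℝ => Real.exp (-(θ * x)) := by fun_prop
  refine (hXY.comp hf hg).integrable_left_of_integrable_op (· * ·) 1 one_ne_zero
    (fun x y => by simp [enorm_mul]) (hθ.congr ?_)
    (hf.comp hX).aestronglyMeasurable (hg.comp hY).aestronglyMeasurable ?_
  · refine ae_of_all _ fun ω => ?_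
    simp only [Function.comp_apply, ← Real.exp_add]
    ring_nf
  · intro h0
    obtain ⟨ω, hω⟩ := h0.exists
    exact (Real.exp_pos _).ne' hω

theorem tendstoInMeasure_of_ae_tendsto {ι E : Type*} [PseudoEMetricSpace E] [IsFiniteMeasure P]
    {l : Filter ι} [l.IsCountablyGenerated] {f : ι → Ω → E} {g : Ω → E}
    (hf : ∀ i, AEStronglyMeasurable (f i) P)
    (h : ∀ᵐ ω ∂P, Tendsto (fun i => f i ω) l (𝓝 (g ω))) : TendstoInMeasure P f l g := by
  intro ε hε
  refine tendsto_of_seq_tendsto fun u hu => ?_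
  refine tendstoInMeasure_of_tendsto_ae (fun n => hf (u n)) ?_ ε hε
  filter_upwards [h] with ω hω using hω.comp hu

/-! ### Stable subordinators and their inverses -/

/-- Self-similarity: `V (t ^ ν * s)` has the law of `t * V s`, since both have the Laplace
transform `ξ ↦ exp (-(t ^ ν * s * ξ ^ ν))`. -/
theorem IsStableSubordinator.measure_le_rpow_mul [IsProbabilityMeasure P] {ν : ℝ}
    {V : ℝ≥0 → Ω → ℝ} (hV : IsStableSubordinator ν V P) {t : ℝ≥0} (ht : 0 < t)
    (s : ℝ≥0) : P {ω | V (t ^ ν * s) ω ≤ t} = P {ω | V s ω ≤ 1} := by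
  have hm1 : Measurable fun ω => (V (t ^ ν * s) ω).toNNReal := (hV.measurable _).real_toNNReal
  have hm2 : Measurable fun ω => (t * V s ω).toNNReal :=
    ((hV.measurable _).const_mul _).real_toNNReal
  have hlaw : P.map (fun ω => (V (t ^ ν * s) ω).toNNReal)
      = P.map (fun ω => (t * V s ω).toNNReal) := by
    have := Measure.isProbabilityMeasure_map (μ := P) hm1.aemeasurable
    have := Measure.isProbabilityMeasure_map (μ := P) hm2.aemeasurable
    refine ext_of_integral_exp_neg_nat fun n => ?_
    rw [integral_map hm1.aemeasurable (by fun_prop), integral_map hm2.aemeasurable (by fun_prop)]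
    have e1 : ∫ ω, Real.exp (-(n * (V (t ^ ν * s) ω).toNNReal)) ∂P
        = ∫ ω, Real.exp (-(n * V (t ^ ν * s) ω)) ∂P := by
      refine integral_congr_ae ?_
      filter_upwards [hV.ae_nonneg] with ω h
      rw [Real.coe_toNNReal _ (h _)]
    have e2 : ∫ ω, Real.exp (-(n * (t * V s ω).toNNReal)) ∂P
        = ∫ ω, Real.exp (-((n * t) * V s ω)) ∂P := by
      refine integral_congr_ae ?_
      filter_upwards [hV.ae_nonneg] with ω h
      rw [Real.coe_toNNReal (t * V s ω) (mul_nonneg t.2 (h _)), mul_assoc]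
    rw [e1, e2, hV.laplace _ _ (by positivity), hV.laplace _ _ (by positivity),
      Real.mul_rpow (by positivity) (by positivity)]
    push_cast
    ring_nf
  have := congrArg (fun ρ : Measure ℝ≥0 => ρ (Set.Iic t)) hlaw
  simp only [Measure.map_apply hm1 measurableSet_Iic, Measure.map_apply hm2 measurableSet_Iic]
    at this
  convert this using 2
  · ext ω; simp [Real.toNNReal_le_iff_le_coe]
  · ext ω
    have ht' : (0 : ℝ) < t := ht
    simp only [Set.mem_ofPred_eq, Set.mem_preimage, Set.mem_Iic, Real.toNNReal_le_iff_le_coe]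
    exact (mul_le_iff_le_one_right ht').symm

/-- The paths of a stable subordinator are unbounded: by Chernoff's bound a path stays below `n` up
to time `k` with probability at most `exp (n - k)`, for every `k`. In particular the infimum that
defines the inverse is never that of an empty set. -/
theorem IsStableSubordinator.ae_exists_lt [IsProbabilityMeasure P] {ν : ℝ}
    {V : ℝ≥0 → Ω → ℝ} (hV : IsStableSubordinator ν V P) :
    ∀ᵐ ω ∂P, ∀ x : ℝ, ∃ s, x < V s ω := by
  have h : ∀ n : ℕ, ∀ᵐ ω ∂P, ∃ s, (n : ℝ) < V s ω := by
    intro n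
    rw [ae_iff]
    have hb : ∀ k : ℕ, P.real {ω | ¬ ∃ s, (n : ℝ) < V s ω} ≤ Real.exp n * Real.exp (-k) := by
      intro k
      have hl := hV.laplace k 1 zero_le_one
      have hint : Integrable (fun ω => Real.exp (-1 * V k ω)) P := by
        -- a non-integrable function would have integral `0`, against the Laplace transform
        refine Integrable.of_integral_ne_zero ?_
        simp only [one_mul] at hl
        simp only [neg_one_mul, hl]
        exact (Real.exp_pos _).ne'
      have hle := measure_le_le_exp_mul_mgf (n : ℝ) (by norm_num) hint
      simp only [mgf, neg_one_mul, one_mul, neg_neg, Real.one_rpow, mul_one, NNReal.coe_natCast]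
        at hle hl
      rw [hl] at hle
      refine (measureReal_mono ?_).trans hle
      intro ω hω
      simp only [Set.mem_ofPred_eq, not_exists, not_lt] at hω ⊢
      exact hω k
    have hlim : Tendsto (fun k : ℕ => Real.exp n * Real.exp (-k)) atTop (𝓝 (Real.exp n * 0)) :=
      (Real.tendsto_exp_neg_atTop_nhds_zero.comp tendsto_natCast_atTop_atTop).const_mul _
    rw [mul_zero] at hlim
    exact (measureReal_eq_zero_iff).1 (le_antisymm (ge_of_tendsto' hlim hb) measureReal_nonneg)
  filter_upwards [ae_all_iff.2 h] with ω hω x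
  obtain ⟨n, hn⟩ := exists_nat_gt x
  obtain ⟨s, hs⟩ := hω n
  exact ⟨s, hn.trans hs⟩

theorem IsInverseStableSubordinator.ae_tendsto_atTop [IsProbabilityMeasure P] {ν : ℝ}
    {L : ℝ≥0 → Ω → ℝ≥0} (hL : IsInverseStableSubordinator ν L P) :
    ∀ᵐ ω ∂P, Tendsto (fun t => L t ω) atTop atTop := by
  obtain ⟨-, V, hV, hLV⟩ := hL
  filter_upwards [hV.monotone, hV.ae_exists_lt, hLV] with ω hm hu hω
  refine tendsto_atTop.2 fun b => ?_
  filter_upwards [eventually_ge_atTop (V b ω).toNNReal] with t ht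
  rw [hω t]
  refine le_csInf (hu t) fun s hs => ?_
  by_contra! hlt
  exact absurd hs (not_lt.2 ((hm hlt.le).trans (Real.toNNReal_le_iff_le_coe.1 ht)))

/-- The event `V s ≤ t` lies, up to a null set, between `s < L t` and `s ≤ L t`. -/
theorem IsInverseStableSubordinator.exists_measure_le [IsProbabilityMeasure P] {ν : ℝ}
    {L : ℝ≥0 → Ω → ℝ≥0} (hL : IsInverseStableSubordinator ν L P) :
    ∃ V : ℝ≥0 → Ω → ℝ, IsStableSubordinator ν V P ∧ ∀ t s : ℝ≥0,
      P {ω | s < L t ω} ≤ P {ω | V s ω ≤ t} ∧ P {ω | V s ω ≤ t} ≤ P {ω | s ≤ L t ω} := by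
  obtain ⟨-, V, hV, hLV⟩ := hL
  refine ⟨V, hV, fun t s => ⟨measure_mono_ae ?_, measure_mono_ae ?_⟩⟩
  · filter_upwards [hLV] with ω hω h
    change s < L t ω at h
    change V s ω ≤ t
    by_contra! hlt
    rw [hω t] at h
    exact absurd (csInf_le (OrderBot.bddBelow _) (show s ∈ {s | (t : ℝ) < V s ω} from hlt))
      (not_le.2 h)
  · filter_upwards [hV.monotone, hV.ae_exists_lt, hLV] with ω hm hu hω h
    change V s ω ≤ t at h
    change s ≤ L t ω
    rw [hω t]
    refine le_csInf (hu t) fun r hr => ?_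
    by_contra! hlt
    exact absurd hr (not_lt.2 ((hm hlt.le).trans h))

/-- The one-dimensional laws of the inverse of a `ν`-stable subordinator scale with exponent `ν`. -/
theorem IsInverseStableSubordinator.identDistrib [IsProbabilityMeasure P] {ν : ℝ}
    {L : ℝ≥0 → Ω → ℝ≥0} (hL : IsInverseStableSubordinator ν L P) {t : ℝ≥0} (ht : 0 < t) :
    IdentDistrib (L t) (fun ω => t ^ ν * L 1 ω) P P := by
  have hm1 := hL.1 t
  have hm2 : Measurable fun ω => t ^ ν * L 1 ω := (hL.1 1).const_mul _
  have := Measure.isProbabilityMeasure_map (μ := P) hm1.aemeasurable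
  have := Measure.isProbabilityMeasure_map (μ := P) hm2.aemeasurable
  obtain ⟨V, hV, hVL⟩ := hL.exists_measure_le
  have hc : 0 < t ^ ν := NNReal.rpow_pos ht
  refine ⟨hm1.aemeasurable, hm2.aemeasurable, ext_of_measure_Ioi_le_measure_Ici ?_ ?_⟩
  all_goals
    intro s
    obtain ⟨r, rfl⟩ : ∃ r, s = t ^ ν * r := ⟨s / t ^ ν, (mul_div_cancel₀ s hc.ne').symm⟩
    rw [Measure.map_apply (by assumption) measurableSet_Ioi,
      Measure.map_apply (by assumption) measurableSet_Ici]
  · refine ((hVL t _).1.trans_eq (hV.measure_le_rpow_mul ht r)).trans ?_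
    refine (hVL 1 r).2.trans (measure_mono fun ω hω => ?_)
    exact mul_le_mul_right (show r ≤ L 1 ω from hω) _
  · refine le_trans ?_ ((hV.measure_le_rpow_mul ht r).symm.trans_le (hVL t _).2)
    refine le_trans (measure_mono fun ω hω => ?_) (hVL 1 r).1
    exact lt_of_mul_lt_mul_left (show t ^ ν * r < t ^ ν * L 1 ω from hω) hc.le

theorem IsInverseStableSubordinator.ae_tendsto_comp_div [IsProbabilityMeasure P] {ν : ℝ}
    {X : ℝ≥0 → Ω → ℝ} {L : ℝ≥0 → Ω → ℝ≥0} (hL : IsInverseStableSubordinator ν L P)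
    (hX : IsSubordinator X P) (h0 : 0 ∈ interior (integrableExpSet (X 1) P)) :
    ∀ᵐ ω ∂P, Tendsto (fun t => X (L t ω) ω / L t ω) atTop (𝓝 (deriv (cgf (X 1) P) 0)) := by
  have hint : Integrable (X 1) P := by
    simpa using integrable_pow_of_mem_interior_integrableExpSet h0 1
  rw [deriv_cgf_zero h0, probReal_univ, div_one]
  filter_upwards [hL.ae_tendsto_atTop, hX.ae_tendsto_div_atTop hint] with ω h1 h2
  exact h2.comp h1

end TimeChange

theorem mainTheorem6
    {Ω₀ : Type*} [MeasurableSpace Ω₀] (P₀ : Measure Ω₀) [IsProbabilityMeasure P₀]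
    {Ω : Type*} [MeasurableSpace Ω] (P : Measure Ω) [IsProbabilityMeasure P]
    (ν : ℝ) (hν₀ : 0 < ν) (hν₁ : ν < 1)
    -- the light-tailed Lévy process of bounded variation which is not a subordinator
    (S : ℝ≥0 → Ω₀ → ℝ)
    (hS : TimeChange.IsLevyProcess S P₀)
    (hSlight : TimeChange.IsLightTailed S P₀)
    (hSbv : TimeChange.HasBoundedVariation S P₀)
    (hSsub : ¬ TimeChange.IsSubordinator S P₀)
    -- its decomposition as a difference of independent non-null subordinators
    (S₁ S₂ : ℝ≥0 → Ω → ℝ)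
    (hS₁ : TimeChange.IsSubordinator S₁ P) (hS₂ : TimeChange.IsSubordinator S₂ P)
    (hS₁null : ¬ TimeChange.IsNull S₁ P) (hS₂null : ¬ TimeChange.IsNull S₂ P)
    (hS₁S₂ : IndepFun (TimeChange.path S₁) (TimeChange.path S₂) P)
    (hdecomp : IdentDistrib (TimeChange.path S)
      (TimeChange.path fun t ω => S₁ t ω - S₂ t ω) P₀ P)
    -- the two independent inverse stable subordinators
    (L₁ L₂ : ℝ≥0 → Ω → ℝ≥0)
    (hL₁ : TimeChange.IsInverseStableSubordinator ν L₁ P)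
    (hL₂ : TimeChange.IsInverseStableSubordinator ν L₂ P)
    (hL₁L₂ : IndepFun (TimeChange.path L₁) (TimeChange.path L₂) P)
    -- the time changes are independent of the two subordinators
    (hindep : IndepFun (fun ω => (TimeChange.path S₁ ω, TimeChange.path S₂ ω))
      (fun ω => (TimeChange.path L₁ ω, TimeChange.path L₂ ω)) P) :
    TendstoInDistribution
      (fun (t : ℝ≥0) ω =>
        (t : ℝ) ^ (1 - ν) * ((S₁ (L₁ t ω) ω - S₂ (L₂ t ω) ω) / (t : ℝ)))
      atTop
      (fun ω => deriv (cgf (S₁ 1) P) 0 * (L₁ 1 ω : ℝ) - deriv (cgf (S₂ 1) P) 0 * (L₂ 1 ω : ℝ))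
      (fun _ => P) P := by
  have hlight : ∀ᶠ θ in 𝓝 (0 : ℝ),
      Integrable (fun ω => Real.exp (θ * (S₁ 1 ω - S₂ 1 ω))) P := by
    filter_upwards [hSlight] with θ hθ
    have hu : Measurable fun x : ℝ≥0 → ℝ => Real.exp (θ * x 1) := by fun_prop
    exact (hdecomp.comp hu).integrable_iff.1 hθ
  have hind1 : IndepFun (S₁ 1) (S₂ 1) P :=
    hS₁S₂.comp (measurable_pi_apply (1 : ℝ≥0)) (measurable_pi_apply (1 : ℝ≥0))
  have hexp₁ : 0 ∈ interior (integrableExpSet (S₁ 1) P) :=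
    TimeChange.zero_mem_interior_integrableExpSet_of_indepFun (hS₁.measurable 1)
      (hS₂.measurable 1) hind1 hlight
  have hexp₂ : 0 ∈ interior (integrableExpSet (S₂ 1) P) := by
    refine TimeChange.zero_mem_interior_integrableExpSet_of_indepFun (hS₂.measurable 1)
      (hS₁.measurable 1) hind1.symm ?_
    have hneg : Tendsto (fun θ : ℝ => -θ) (𝓝 0) (𝓝 0) := by
      simpa using (continuous_neg (G := ℝ)).tendsto 0
    filter_upwards [hneg.eventually hlight] with θ hθ
    simpa only [neg_mul, ← mul_neg, neg_sub] using hθ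
  have hS₁L : ∀ t, AEMeasurable (fun ω => S₁ (L₁ t ω) ω) P :=
    fun t => hS₁.aemeasurable_comp (hL₁.1 t)
  have hS₂L : ∀ t, AEMeasurable (fun ω => S₂ (L₂ t ω) ω) P :=
    fun t => hS₂.aemeasurable_comp (hL₂.1 t)
  have hLm : ∀ t, Measurable fun ω => ((L₁ t ω : ℝ), (L₂ t ω : ℝ)) := fun t =>
    (hL₁.1 t).coe_nnreal_real.prodMk (hL₂.1 t).coe_nnreal_real
  -- each rescaled coordinate has a law that does not depend on `t`; independence carries this over
  -- to the joint law
  have hscale : ∀ t : ℝ≥0, 0 < t → IdentDistrib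
      (fun ω => ((t : ℝ) ^ ν)⁻¹ • ((L₁ t ω : ℝ), (L₂ t ω : ℝ)))
      (fun ω => ((L₁ 1 ω : ℝ), (L₂ 1 ω : ℝ))) P P := by
    intro t ht
    have hmul : Measurable fun x : ℝ≥0 → ℝ≥0 => t ^ ν * x 1 :=
      (measurable_pi_apply (1 : ℝ≥0)).const_mul _
    have hpair : IdentDistrib (fun ω => (L₁ t ω, L₂ t ω))
        (fun ω => (t ^ ν * L₁ 1 ω, t ^ ν * L₂ 1 ω)) P P :=
      (hL₁.identDistrib ht).prodMk (hL₂.identDistrib ht)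
        (hL₁L₂.comp (measurable_pi_apply t) (measurable_pi_apply t)) (hL₁L₂.comp hmul hmul)
    have hu : Measurable fun p : ℝ≥0 × ℝ≥0 => ((t : ℝ) ^ ν)⁻¹ • ((p.1 : ℝ), (p.2 : ℝ)) := by
      fun_prop
    have hpos : (0 : ℝ) < (t : ℝ) ^ ν := Real.rpow_pos_of_pos ht ν
    convert hpair.comp hu using 1 <;> funext ω
    · rfl
    · simp [hpos.ne']
  have hB : TendstoInDistribution
      (fun (t : ℝ≥0) ω => ((t : ℝ) ^ ν)⁻¹ • ((L₁ t ω : ℝ), (L₂ t ω : ℝ))) atTop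
      (fun ω => ((L₁ 1 ω : ℝ), (L₂ 1 ω : ℝ))) (fun _ => P) P := by
    refine ⟨fun t => ((hLm t).const_smul ((t : ℝ) ^ ν)⁻¹).aemeasurable, (hLm 1).aemeasurable, ?_⟩
    refine tendsto_const_nhds.congr' ?_
    filter_upwards [eventually_gt_atTop 0] with t ht
    exact Subtype.ext (hscale t ht).map_eq.symm
  have hAm : ∀ t, AEMeasurable
      (fun ω => (S₁ (L₁ t ω) ω / L₁ t ω, S₂ (L₂ t ω) ω / L₂ t ω)) P := fun t =>
    ((hS₁L t).div (hL₁.1 t).coe_nnreal_real.aemeasurable).prodMk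
      ((hS₂L t).div (hL₂.1 t).coe_nnreal_real.aemeasurable)
  have hA : TendstoInMeasure P
      (fun (t : ℝ≥0) ω => (S₁ (L₁ t ω) ω / L₁ t ω, S₂ (L₂ t ω) ω / L₂ t ω)) atTop
      (fun _ => (deriv (cgf (S₁ 1) P) 0, deriv (cgf (S₂ 1) P) 0)) := by
    refine TimeChange.tendstoInMeasure_of_ae_tendsto (fun t => (hAm t).aestronglyMeasurable) ?_
    filter_upwards [hL₁.ae_tendsto_comp_div hS₁ hexp₁, hL₂.ae_tendsto_comp_div hS₂ hexp₂]
      with ω h1 h2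
    exact h1.prodMk_nhds h2
  have hslutsky := hB.continuous_comp_prodMk_of_tendstoInMeasure_const
    (g := fun p : (ℝ × ℝ) × (ℝ × ℝ) => p.2.1 * p.1.1 - p.2.2 * p.1.2) (by fun_prop) hA hAm
  refine hslutsky.congr (fun t => ?_) .rfl
  filter_upwards [hS₁.zero, hS₂.zero] with ω h1 h2
  -- division by `L t ω` is harmless when `L t ω = 0`, since the subordinators start at `0`
  have hcancel : ∀ (X : ℝ≥0 → Ω → ℝ) (s : ℝ≥0), X 0 ω = 0 → X s ω / s * s = X s ω := by
    intro X s h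
    rcases eq_or_ne s 0 with rfl | hs
    · simp [h]
    · exact div_mul_cancel₀ _ (NNReal.coe_ne_zero.2 hs)
  -- at `t = 0` both sides are `0` by the conventions for division
  have hpow : (t : ℝ) ^ (1 - ν) / t = ((t : ℝ) ^ ν)⁻¹ := by
    rcases eq_or_ne t 0 with rfl | ht
    · simp [Real.zero_rpow hν₀.ne']
    · have ht' : (0 : ℝ) < t := NNReal.coe_pos.2 (pos_iff_ne_zero.2 ht)
      rw [Real.rpow_sub ht', Real.rpow_one]
      field_simp
  have c1 := hcancel S₁ (L₁ t ω) h1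
  have c2 := hcancel S₂ (L₂ t ω) h2
  calc _ = ((t : ℝ) ^ ν)⁻¹ * (S₁ (L₁ t ω) ω / L₁ t ω * L₁ t ω
        - S₂ (L₂ t ω) ω / L₂ t ω * L₂ t ω) := by
        simp only [Prod.smul_mk, smul_eq_mul]; ring
    _ = _ := by rw [c1, c2, ← hpow]; ring
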